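/- Let $n\ge 1$, let $z\in\{\pm1\}^n$, and let $W$ be an $n\times n$ Gaussian Wigner matrix: $W$ is symmetric with zero diagonal, and its entries below the diagonal are i.i.d. $\mathcal N(0,1)$. For $\sigma>0$ put $\lambda=\sqrt n/\sigma$ and consider the observation $Y=zz^T+\sigma W$, or equivalently its rescaling $\mathcal Y=\frac{\lambda}{n}Y=\frac{\lambda}{n}zz^T+\frac1{\sqrt n}W$. The rank-2 Burer--Monteiro problem with cost matrix $A\in\{Y,\mathcal Y\}$ is $$\max_{Q\in\mathbb R^{n\times 2}} \operatorname{Tr}(Q^TAQ)\quad\text{subject to}\quad \|Q_{i:}\|_2=1 \text{ for } 1\le i\le n,$$ where $Q_{i:}$ is the $i$th row of $Q$. A feasible $Q$ is a second-order critical point if for every smooth curve $c:\mathbb R\to\mathbb R^{n\times2}$ of feasible points with $c(0)=Q$, the function $t\mapsto \operatorname{Tr}(c(t)^TAc(t))$ has zero first derivative and nonpositive second derivative at $t=0$ (that is, on the product of $n$ circles the Riemannian gradient of the cost vanishes at $Q$ and its Riemannian Hessian at $Q$ is negative semidefinite). Theorem. For every fixed $\lambda>8$ there exists $\varepsilon>0$,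 depending only on $\lambda$, such that the following holds for every choice of $z=z^{(n)}\in\{\pm1\}^n$, $n\ge1$. With $\sigma=\sqrt n/\lambda$, with probability tending to $1$ as $n\to\infty$, every second-order critical point $Q$ of the problem with cost matrix $Y$ satisfies $$\frac1n\|Q^Tz\|_2\ \ge\ \varepsilon ,$$ and the same holds for the problem with cost matrix $\mathcal Y$. -/

import Mathlib

open MeasureTheory ProbabilityTheory Filter Topology Matrix

/-- `W` is a Gaussian Wigner matrix with zero diagonal: symmetric, and the entries strictly below
the diagonal are independent standard Gaussian random variables. -/
structure IsGaussianWigner {Ω : Type*} [MeasurableSpace Ω] {n : ℕ}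
    (W : Ω → Matrix (Fin n) (Fin n) ℝ) (P : Measure Ω) : Prop where
  symm : ∀ ω, (W ω).IsSymm
  diag_eq_zero : ∀ ω i, W ω i i = 0
  hasLaw : ∀ i j : Fin n, j < i → HasLaw (fun ω => W ω i j) (gaussianReal 0 1) P
  indep : iIndepFun
    (fun (p : {p : Fin n × Fin n // p.2 < p.1}) (ω : Ω) => W ω p.1.1 p.1.2) P

/-- The observation `Y = z zᵀ + σ W`. -/
noncomputable def sigmaModel {n : ℕ} (σ : ℝ) (z : Fin n → ℝ) (W : Matrix (Fin n) (Fin n) ℝ) :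
    Matrix (Fin n) (Fin n) ℝ :=
  vecMulVec z z + σ • W

/-- The scaled observation `(lam / n) z zᵀ + (1 / √n) W`. -/
noncomputable def lambdaModel {n : ℕ} (lam : ℝ) (z : Fin n → ℝ) (W : Matrix (Fin n) (Fin n) ℝ) :
    Matrix (Fin n) (Fin n) ℝ :=
  (lam / (n : ℝ)) • vecMulVec z z + (1 / √(n : ℝ)) • W

/-- The search space of the rank-2 problem: real `n × 2` matrices whose rows have unit
Euclidean norm, a product of `n` circles. -/
def productOfCircles (n : ℕ) : Set (Matrix (Fin n) (Fin 2) ℝ) :=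
  {Q | ∀ i, ∑ k, Q i k ^ 2 = 1}

/-- The cost `Q ↦ Tr(Qᵀ Y Q)`. -/
def bmCost {n : ℕ} (Y : Matrix (Fin n) (Fin n) ℝ) (Q : Matrix (Fin n) (Fin 2) ℝ) : ℝ :=
  (Qᵀ * Y * Q).trace

/-- `Q` is a second-order critical point of the problem `max f` over the embedded submanifold `M`
of a matrix space (for `f` smooth): `Q` lies in `M` and, along every smooth curve `c` in `M` with
`c 0 = Q`, the function `f ∘ c` has zero first derivative and nonpositive second derivative at `0`.
Equivalently, the Riemannian gradient of `f` vanishes at `Q` and its Riemannian Hessian at `Q` is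
negative semidefinite. -/
def IsSecondOrderCriticalMax {m k : Type*} (M : Set (Matrix m k ℝ)) (f : Matrix m k ℝ → ℝ)
    (Q : Matrix m k ℝ) : Prop :=
  Q ∈ M ∧ ∀ c : ℝ → Matrix m k ℝ, (∀ i j, ContDiff ℝ (⊤ : ℕ∞) (fun t => c t i j)) →
    (∀ t, c t ∈ M) → c 0 = Q →
      deriv (fun t => f (c t)) 0 = 0 ∧ iteratedDeriv 2 (fun t => f (c t)) 0 ≤ 0

/-- Second-order critical points of the rank-2 Burer-Monteiro problem with cost matrix `Y`:
maximize `Tr(Qᵀ Y Q)` over real `n × 2` matrices with unit rows. -/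
def IsRank2BMSecondOrderCritical {n : ℕ} (Y : Matrix (Fin n) (Fin n) ℝ)
    (Q : Matrix (Fin n) (Fin 2) ℝ) : Prop :=
  IsSecondOrderCriticalMax (productOfCircles n) (bmCost Y) Q

/-- The events `E n` hold with high probability as `n → ∞`: the (outer) measure of the complement
tends to `0`. -/
def WithHighProbability {Ω : ℕ → Type*} [∀ n, MeasurableSpace (Ω n)]
    (P : ∀ n, Measure (Ω n)) (E : ∀ n, Set (Ω n)) : Prop :=
  Tendsto (fun n => P n (E n)ᶜ) atTop (𝓝 0)

/-! Rotating row `Q i` of a second-order critical point at speed `u i` turns the Hessian condition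
into `∑ Y i j (u i - u j)² ⟪Q i, Q j⟫ ≥ 0`. Adding the cases `u = z · Q_0` and `u = z · Q_1`
(columns of `Q`) gives `∑ Y i j (⟪Q i, Q j⟫ - z i z j ⟪Q i, Q j⟫²) ≥ 0`. The signal part of this sum
is proportional to `‖Qᵀz‖² - ‖QᵀQ‖_F²`, and `‖QᵀQ‖_F² ≥ n²/2` because `QᵀQ` is 2 × 2 with trace `n`.
If `‖W‖ ≤ C√n`, the noise contributes at most `2C√n · n` before scaling. Hence `(‖Qᵀz‖/n)² ≥ 1/2 -
2C/lam` (`correlation_lower_bound`), which is positive when `lam > 4C`; the threshold 8 corresponds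
to `C` close to 2.

That every `C > 2` works with high probability is proved by induction on dimension for a full matrix
`A` of independent Gaussians, carrying a rank-one term `⟪v, u⟫²/s`. Rotation invariance aligns `v`
with the first axis. Completing the square in the first coordinate then removes the first row and
column and leaves a term of the same shape, whose new `v` is Gaussian and independent of the
remaining block (`mem_exceedSet_of_succ`, `iidGaussian_exceedSet_succ_le`). Each step fails with
exponentially small probability once `s²/2` exceeds `n` by a constant factor. Symmetrizing `A`
multiplies the resulting bound, about `√(2n)`, by `√2`. -/

/-! ### The Hessian inequality and its deterministic consequence -/

lemma bmCost_eq_sum {n : ℕ} (Y : Matrix (Fin n) (Fin n) ℝ) (Q : Matrix (Fin n) (Fin 2) ℝ) :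
    bmCost Y Q = ∑ i, ∑ j, Y i j * (Q i 0 * Q j 0 + Q i 1 * Q j 1) := by
  simp only [bmCost, trace, diag, mul_apply, transpose_apply, Fin.sum_univ_two, Finset.sum_mul]
  rw [← Finset.sum_add_distrib, Finset.sum_comm]
  simp only [← Finset.sum_add_distrib]
  exact Finset.sum_congr rfl fun i _ => Finset.sum_congr rfl fun j _ => by ring

/-- The curve rotating row `i` of `Q` at angular speed `u i`. -/
noncomputable def rotateRows {n : ℕ} (u : Fin n → ℝ) (Q : Matrix (Fin n) (Fin 2) ℝ) (t : ℝ) :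
    Matrix (Fin n) (Fin 2) ℝ :=
  fun i => ![Real.cos (t * u i) * Q i 0 - Real.sin (t * u i) * Q i 1,
    Real.cos (t * u i) * Q i 1 + Real.sin (t * u i) * Q i 0]

lemma bmCost_rotateRows {n : ℕ} (Y : Matrix (Fin n) (Fin n) ℝ) (u : Fin n → ℝ)
    (Q : Matrix (Fin n) (Fin 2) ℝ) (t : ℝ) :
    bmCost Y (rotateRows u Q t) = ∑ i, ∑ j, Y i j *
      (Real.cos (t * (u i - u j)) * (Q i 0 * Q j 0 + Q i 1 * Q j 1) +
        Real.sin (t * (u i - u j)) * (Q i 0 * Q j 1 - Q i 1 * Q j 0)) := by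
  rw [bmCost_eq_sum]
  refine Finset.sum_congr rfl fun i _ => Finset.sum_congr rfl fun j _ => ?_
  simp only [rotateRows, cons_val_zero, cons_val_one, mul_sub, Real.cos_sub, Real.sin_sub]
  ring

/-- The Riemannian Hessian condition: the Laplacian with weights `Y i j * ⟪Q i, Q j⟫` is positive
semidefinite. -/
lemma IsRank2BMSecondOrderCritical.laplacian_nonneg {n : ℕ} {Y : Matrix (Fin n) (Fin n) ℝ}
    {Q : Matrix (Fin n) (Fin 2) ℝ} (h : IsRank2BMSecondOrderCritical Y Q) (u : Fin n → ℝ) :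
    0 ≤ ∑ i, ∑ j, Y i j * ((u i - u j) ^ 2 * (Q i 0 * Q j 0 + Q i 1 * Q j 1)) := by
  obtain ⟨hQ, hc⟩ := h
  have h2 := (hc (rotateRows u Q) ?_ ?_ ?_).2
  · have e1 : deriv (fun t => bmCost Y (rotateRows u Q t)) = fun t => ∑ i, ∑ j, Y i j *
        (-(Real.sin (t * (u i - u j)) * (u i - u j)) * (Q i 0 * Q j 0 + Q i 1 * Q j 1) +
        Real.cos (t * (u i - u j)) * (u i - u j) * (Q i 0 * Q j 1 - Q i 1 * Q j 0)) := by
      funext t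
      simp only [bmCost_rotateRows]
      refine HasDerivAt.deriv (HasDerivAt.fun_sum fun i _ => HasDerivAt.fun_sum fun j _ => ?_)
      have hl : HasDerivAt (fun t : ℝ => t * (u i - u j)) (u i - u j) t := by
        simpa using (hasDerivAt_id t).mul_const (u i - u j)
      simpa using ((hl.cos.mul_const _).add (hl.sin.mul_const _)).const_mul (Y i j)
    have e2 : deriv (fun t => ∑ i, ∑ j, Y i j *
        (-(Real.sin (t * (u i - u j)) * (u i - u j)) * (Q i 0 * Q j 0 + Q i 1 * Q j 1) +
        Real.cos (t * (u i - u j)) * (u i - u j) * (Q i 0 * Q j 1 - Q i 1 * Q j 0))) 0 =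
        ∑ i, ∑ j, Y i j * (-((u i - u j) ^ 2 * (Q i 0 * Q j 0 + Q i 1 * Q j 1))) := by
      refine HasDerivAt.deriv (HasDerivAt.fun_sum fun i _ => HasDerivAt.fun_sum fun j _ => ?_)
      have hl : HasDerivAt (fun t : ℝ => t * (u i - u j)) (u i - u j) 0 := by
        simpa using (hasDerivAt_id (0 : ℝ)).mul_const (u i - u j)
      refine (((((hl.sin.mul_const (u i - u j)).neg).mul_const _).add
        ((hl.cos.mul_const (u i - u j)).mul_const _)).const_mul (Y i j)).congr_deriv ?_
      simp only [zero_mul, Real.cos_zero, Real.sin_zero]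
      ring
    rw [iteratedDeriv_succ, iteratedDeriv_one, e1, e2] at h2
    simp only [mul_neg, Finset.sum_neg_distrib] at h2
    linarith
  · intro i j
    obtain rfl | rfl : j = 0 ∨ j = 1 := by omega
    · change ContDiff ℝ _ fun t => Real.cos (t * u i) * Q i 0 - Real.sin (t * u i) * Q i 1
      fun_prop
    · change ContDiff ℝ _ fun t => Real.cos (t * u i) * Q i 1 + Real.sin (t * u i) * Q i 0
      fun_prop
  · intro t i
    have := hQ i
    simp only [Fin.sum_univ_two] at this
    simp only [rotateRows, Fin.sum_univ_two, cons_val_zero, cons_val_one]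
    linear_combination (Q i 0 ^ 2 + Q i 1 ^ 2) * Real.sin_sq_add_cos_sq (t * u i) + this
  · ext i k
    fin_cases k <;> simp [rotateRows]

/-- The two test vectors are the columns of `Q` with row `i` multiplied by `z i`. Since these signed
rows are unit vectors, their squared distances are `2 - 2 z i z j ⟪Q i, Q j⟫`. -/
lemma IsRank2BMSecondOrderCritical.sum_nonneg {n : ℕ} {Y : Matrix (Fin n) (Fin n) ℝ}
    {Q : Matrix (Fin n) (Fin 2) ℝ} (h : IsRank2BMSecondOrderCritical Y Q) {z : Fin n → ℝ}
    (hz : ∀ i, z i = 1 ∨ z i = -1) :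
    0 ≤ ∑ i, ∑ j, Y i j * ((Q i 0 * Q j 0 + Q i 1 * Q j 1) -
      z i * z j * (Q i 0 * Q j 0 + Q i 1 * Q j 1) ^ 2) := by
  have h0 := h.laplacian_nonneg fun i => z i * Q i 0
  have h1 := h.laplacian_nonneg fun i => z i * Q i 1
  have key : ∑ i, ∑ j, Y i j * ((z i * Q i 0 - z j * Q j 0) ^ 2 * (Q i 0 * Q j 0 + Q i 1 * Q j 1)) +
      ∑ i, ∑ j, Y i j * ((z i * Q i 1 - z j * Q j 1) ^ 2 * (Q i 0 * Q j 0 + Q i 1 * Q j 1)) =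
      2 * ∑ i, ∑ j, Y i j * ((Q i 0 * Q j 0 + Q i 1 * Q j 1) -
      z i * z j * (Q i 0 * Q j 0 + Q i 1 * Q j 1) ^ 2) := by
    simp only [Finset.mul_sum, ← Finset.sum_add_distrib]
    refine Finset.sum_congr rfl fun i _ => Finset.sum_congr rfl fun j _ => ?_
    have hi := h.1 i
    have hj := h.1 j
    simp only [Fin.sum_univ_two] at hi hj
    have zi : z i ^ 2 = 1 := by rcases hz i with h | h <;> simp [h]
    have zj : z j ^ 2 = 1 := by rcases hz j with h | h <;> simp [h]
    linear_combination (Y i j * (Q i 0 * Q j 0 + Q i 1 * Q j 1)) *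
      (z i ^ 2 * hi + zi + z j ^ 2 * hj + zj)
  linarith

/-- If the quadratic form of `W` is bounded by `C * √n` in absolute value, the Hessian inequality
forces correlation with `z`. -/
lemma correlation_lower_bound {n : ℕ} (hn : 0 < n) {lam C : ℝ} (hlam : 0 < lam)
    {W : Matrix (Fin n) (Fin n) ℝ}
    (hW : ∀ u : Fin n → ℝ, |∑ i, ∑ j, W i j * (u i * u j)| ≤ C * √n * ∑ i, u i ^ 2)
    {z : Fin n → ℝ} (hz : ∀ i, z i = 1 ∨ z i = -1) {Q : Matrix (Fin n) (Fin 2) ℝ}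
    (hQ : Q ∈ productOfCircles n)
    (h : 0 ≤ ∑ i, ∑ j, lambdaModel lam z W i j * ((Q i 0 * Q j 0 + Q i 1 * Q j 1) -
      z i * z j * (Q i 0 * Q j 0 + Q i 1 * Q j 1) ^ 2)) :
    1 / 2 - 2 * C / lam ≤ (1 / (n : ℝ) * ‖WithLp.toLp 2 (Qᵀ *ᵥ z)‖) ^ 2 := by
  have hnR : (0 : ℝ) < n := by exact_mod_cast hn
  have hs : √(n : ℝ) ^ 2 = n := Real.sq_sqrt hnR.le
  have hs0 : 0 < √(n : ℝ) := Real.sqrt_pos.2 hnR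
  have hq : ∀ i, Q i 0 ^ 2 + Q i 1 ^ 2 = 1 := fun i => by simpa using hQ i
  have hzz : ∀ i, z i * z i = 1 := fun i => by rcases hz i with h | h <;> simp [h]
  set q := fun u : Fin n → ℝ => ∑ i, ∑ j, W i j * (u i * u j) with hqd
  have hnorm : ‖WithLp.toLp 2 (Qᵀ *ᵥ z)‖ ^ 2 = (∑ i, Q i 0 * z i) ^ 2 + (∑ i, Q i 1 * z i) ^ 2 := by
    simp [EuclideanSpace.norm_sq_eq, mulVec, dotProduct]
  have sq_sum : ∀ f : Fin n → ℝ, (∑ i, f i) ^ 2 = ∑ i, ∑ j, f i * f j := fun f => by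
    rw [sq, Finset.sum_mul_sum]
  have hsig : ∑ i, ∑ j, z i * z j * ((Q i 0 * Q j 0 + Q i 1 * Q j 1) -
      z i * z j * (Q i 0 * Q j 0 + Q i 1 * Q j 1) ^ 2) =
      (∑ i, Q i 0 * z i) ^ 2 + (∑ i, Q i 1 * z i) ^ 2 -
      ((∑ i, Q i 0 ^ 2) ^ 2 + 2 * (∑ i, Q i 0 * Q i 1) ^ 2 + (∑ i, Q i 1 ^ 2) ^ 2) := by
    simp only [sq_sum, Finset.mul_sum, ← Finset.sum_add_distrib,
      ← Finset.sum_sub_distrib]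
    refine Finset.sum_congr rfl fun i _ => Finset.sum_congr rfl fun j _ => ?_
    linear_combination (-(Q i 0 * Q j 0 + Q i 1 * Q j 1) ^ 2) * (hzz i * (z j * z j) + hzz j)
  -- The square `⟪Q i, Q j⟫²` is the inner product of the tensor squares of the rows, so the noise
  -- splits into quadratic forms of `W`. The two groups of vectors each have total squared length
  -- `n` (`hN1`, `hN2`).
  have hnoise : ∑ i, ∑ j, W i j * ((Q i 0 * Q j 0 + Q i 1 * Q j 1) -
      z i * z j * (Q i 0 * Q j 0 + Q i 1 * Q j 1) ^ 2) =
      q (fun i => Q i 0) + q (fun i => Q i 1) - (q (fun i => z i * (Q i 0 * Q i 0)) +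
        2 * q (fun i => z i * (Q i 0 * Q i 1)) + q (fun i => z i * (Q i 1 * Q i 1))) := by
    simp only [hqd, Finset.mul_sum, ← Finset.sum_add_distrib, ← Finset.sum_sub_distrib]
    refine Finset.sum_congr rfl fun i _ => Finset.sum_congr rfl fun j _ => ?_
    ring
  have hsplit : ∑ i, ∑ j, lambdaModel lam z W i j * ((Q i 0 * Q j 0 + Q i 1 * Q j 1) -
      z i * z j * (Q i 0 * Q j 0 + Q i 1 * Q j 1) ^ 2) =
      lam / n * ∑ i, ∑ j, z i * z j * ((Q i 0 * Q j 0 + Q i 1 * Q j 1) -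
        z i * z j * (Q i 0 * Q j 0 + Q i 1 * Q j 1) ^ 2) +
      1 / √n * ∑ i, ∑ j, W i j * ((Q i 0 * Q j 0 + Q i 1 * Q j 1) -
        z i * z j * (Q i 0 * Q j 0 + Q i 1 * Q j 1) ^ 2) := by
    simp only [Finset.mul_sum, ← Finset.sum_add_distrib]
    refine Finset.sum_congr rfl fun i _ => Finset.sum_congr rfl fun j _ => ?_
    simp only [lambdaModel, Matrix.add_apply, Matrix.smul_apply, vecMulVec_apply, smul_eq_mul]
    ring
  have hN1 : ∑ i, Q i 0 ^ 2 + ∑ i, Q i 1 ^ 2 = (n : ℝ) := by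
    simp [← Finset.sum_add_distrib, hq]
  have hN2 : ∑ i, (z i * (Q i 0 * Q i 0)) ^ 2 + 2 * ∑ i, (z i * (Q i 0 * Q i 1)) ^ 2 +
      ∑ i, (z i * (Q i 1 * Q i 1)) ^ 2 = (n : ℝ) := by
    rw [Finset.mul_sum, ← Finset.sum_add_distrib, ← Finset.sum_add_distrib]
    trans ∑ i : Fin n, (1 : ℝ)
    · refine Finset.sum_congr rfl fun i _ => ?_
      linear_combination (Q i 0 ^ 2 + Q i 1 ^ 2) ^ 2 * hzz i + (Q i 0 ^ 2 + Q i 1 ^ 2 + 1) * hq i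
    · simp
  have hn2 : q (fun i => Q i 0) + q (fun i => Q i 1) - (q (fun i => z i * (Q i 0 * Q i 0)) +
        2 * q (fun i => z i * (Q i 0 * Q i 1)) + q (fun i => z i * (Q i 1 * Q i 1))) ≤
        2 * (C * √n * n) := by
    have b1 := (abs_le.1 (hW fun i => Q i 0)).2
    have b2 := (abs_le.1 (hW fun i => Q i 1)).2
    have b3 := (abs_le.1 (hW fun i => z i * (Q i 0 * Q i 0))).1
    have b4 := (abs_le.1 (hW fun i => z i * (Q i 0 * Q i 1))).1
    have b5 := (abs_le.1 (hW fun i => z i * (Q i 1 * Q i 1))).1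
    linear_combination b1 + b2 + b3 + 2 * b4 + b5 + C * √n * hN1 + C * √n * hN2
  -- The right side is `‖QᵀQ‖_F²`, which Cauchy–Schwarz on two eigenvalues bounds below by half the
  -- squared trace.
  have hsig2 : (n : ℝ) ^ 2 / 2 ≤
      (∑ i, Q i 0 ^ 2) ^ 2 + 2 * (∑ i, Q i 0 * Q i 1) ^ 2 + (∑ i, Q i 1 ^ 2) ^ 2 := by
    nlinarith [sq_nonneg (∑ i, Q i 0 ^ 2 - ∑ i, Q i 1 ^ 2), sq_nonneg (∑ i, Q i 0 * Q i 1)]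
  rw [hsplit, hsig, hnoise, ← hnorm] at h
  have hfin : 0 ≤ lam / n * (‖WithLp.toLp 2 (Qᵀ *ᵥ z)‖ ^ 2 - (n : ℝ) ^ 2 / 2) +
      1 / √n * (2 * (C * √n * n)) :=
    h.trans (by gcongr)
  have e1 : 1 / √(n : ℝ) * (2 * (C * √n * n)) = 2 * C * n := by field_simp
  rw [e1] at hfin
  have e2 : (1 / (n : ℝ) * ‖WithLp.toLp 2 (Qᵀ *ᵥ z)‖) ^ 2 - (1 / 2 - 2 * C / lam) =
      (lam / n * (‖WithLp.toLp 2 (Qᵀ *ᵥ z)‖ ^ 2 - (n : ℝ) ^ 2 / 2) + 2 * C * n) / (lam * n) := by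
    field_simp
    ring
  have := div_nonneg hfin (mul_pos hlam hnR).le
  linarith

lemma sigmaModel_eq_smul_lambdaModel {n : ℕ} (hn : 0 < n) {lam : ℝ} (hlam : 0 < lam)
    (z : Fin n → ℝ) (W : Matrix (Fin n) (Fin n) ℝ) :
    sigmaModel (√(n : ℝ) / lam) z W = (n / lam : ℝ) • lambdaModel lam z W := by
  have hnR : (0 : ℝ) < n := by exact_mod_cast hn
  have hs : √(n : ℝ) ^ 2 = n := Real.sq_sqrt hnR.le
  have hs0 : 0 < √(n : ℝ) := Real.sqrt_pos.2 hnR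
  ext i j
  simp only [sigmaModel, lambdaModel, Matrix.add_apply, Matrix.smul_apply, vecMulVec_apply, smul_eq_mul]
  field_simp
  linear_combination W i j * hs

/-! ### Gaussian vectors: orthogonal invariance and tail bounds -/

/-- The law of a family of independent standard Gaussian random variables indexed by `ι`. -/
noncomputable abbrev iidGaussian (ι : Type*) [Fintype ι] : Measure (ι → ℝ) :=
  Measure.pi fun _ => gaussianReal 0 1

/-- The standard Gaussian characteristic function depends only on the norm of its argument, and
orthonormal rows preserve norms. The rows need not span, so marginals are covered too. -/
lemma measurePreserving_dotProduct_iidGaussian {ι κ : Type*} [Fintype ι] [Fintype κ]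
    [DecidableEq κ] (r : κ → ι → ℝ) (hr : ∀ k l, r k ⬝ᵥ r l = if k = l then 1 else 0) :
    MeasurePreserving (fun (x : ι → ℝ) (k : κ) => r k ⬝ᵥ x) (iidGaussian ι) (iidGaussian κ) := by
  have hm : Measurable fun (x : ι → ℝ) (k : κ) => r k ⬝ᵥ x := by
    unfold dotProduct; fun_prop
  refine ⟨hm, ?_⟩
  have h : ((iidGaussian ι).map fun (x : ι → ℝ) (k : κ) => r k ⬝ᵥ x).map (WithLp.toLp 2) =
      (iidGaussian κ).map (WithLp.toLp 2) := by
    have : IsProbabilityMeasure ((iidGaussian ι).map fun (x : ι → ℝ) (k : κ) => r k ⬝ᵥ x) :=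
      Measure.isProbabilityMeasure_map hm.aemeasurable
    apply Measure.ext_of_charFun (E := EuclideanSpace ℝ κ)
    ext t
    have e : charFun (((iidGaussian ι).map fun (x : ι → ℝ) (k : κ) => r k ⬝ᵥ x).map
        (WithLp.toLp 2)) t =
        charFun ((iidGaussian ι).map (WithLp.toLp 2)) (WithLp.toLp 2 (∑ k, t k • r k)) := by
      rw [charFun_apply, charFun_apply, integral_map (by fun_prop) (by fun_prop),
        integral_map (by fun_prop) (by fun_prop), integral_map (by fun_prop) (by fun_prop)]
      congr with x
      congr 3
      simp only [PiLp.inner_apply, RCLike.inner_apply, conj_trivial, dotProduct,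
        Finset.sum_apply, Pi.smul_apply, smul_eq_mul, Finset.mul_sum, Finset.sum_mul]
      rw [Finset.sum_comm]
      exact Finset.sum_congr rfl fun i _ => Finset.sum_congr rfl fun j _ => by ring
    rw [e, map_pi_eq_stdGaussian, map_pi_eq_stdGaussian, charFun_stdGaussian, charFun_stdGaussian]
    have e2 : ‖WithLp.toLp 2 (∑ k, t k • r k)‖ ^ 2 = ‖t‖ ^ 2 := by
      rw [EuclideanSpace.real_norm_sq_eq, EuclideanSpace.real_norm_sq_eq]
      trans (∑ k, t k • r k) ⬝ᵥ (∑ k, t k • r k)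
      · simp only [dotProduct, sq]
      · simp [sum_dotProduct, dotProduct_sum, hr, sq]
    rw [← Complex.ofReal_pow, e2, Complex.ofReal_pow]
  have h1 : ∀ μ : Measure (κ → ℝ), (μ.map (WithLp.toLp 2)).map WithLp.ofLp = μ := fun μ => by
    rw [Measure.map_map (by fun_prop) (by fun_prop)]
    exact Measure.map_id
  rw [← h1 (Measure.map _ _), h, h1]

lemma integrable_exp_mul_sq_gaussianReal {θ : ℝ} (hθ : θ < 1 / 2) :
    Integrable (fun x : ℝ => Real.exp (θ * x ^ 2)) (gaussianReal 0 1) := by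
  rw [gaussianReal_of_var_ne_zero _ one_ne_zero,
    integrable_withDensity_iff_integrable_smul₀' (by fun_prop) (by simp [gaussianPDF])]
  have := (integrable_exp_neg_mul_sq (b := 1 / 2 - θ) (by linarith)).const_mul (√(2 * Real.pi))⁻¹
  refine this.congr (Eventually.of_forall fun x => ?_)
  simp only [toReal_gaussianPDF, gaussianPDFReal, NNReal.coe_one, mul_one, sub_zero, smul_eq_mul]
  rw [mul_assoc, ← Real.exp_add]
  congr 2
  ring

lemma mgf_sq_gaussianReal {θ : ℝ} (hθ : θ < 1 / 2) :
    mgf (fun x => x ^ 2) (gaussianReal 0 1) θ = (√(1 - 2 * θ))⁻¹ := by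
  rw [mgf, integral_gaussianReal_eq_integral_smul one_ne_zero]
  trans ∫ x : ℝ, (√(2 * Real.pi))⁻¹ * Real.exp (-(1 / 2 - θ) * x ^ 2)
  · congr with x
    simp only [gaussianPDFReal, NNReal.coe_one, mul_one, sub_zero, smul_eq_mul]
    rw [mul_assoc, ← Real.exp_add]
    congr 2
    ring
  · rw [integral_const_mul, integral_gaussian, ← Real.sqrt_inv, ← Real.sqrt_inv,
      ← Real.sqrt_mul (by positivity)]
    congr 1
    have : 1 - 2 * θ ≠ 0 := by linarith
    have : 1 / 2 - θ ≠ 0 := by linarith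
    field_simp

/-- Chernoff bound for sums of squares of independent standard Gaussian variables. -/
lemma iidGaussian_sum_sq_ge_le {ι : Type*} [Fintype ι] (s : Finset ι) {θ : ℝ} (h0 : 0 ≤ θ)
    (hθ : θ < 1 / 2) (c : ℝ) :
    iidGaussian ι {x | c ≤ ∑ i ∈ s, x i ^ 2} ≤
      ENNReal.ofReal (Real.exp (-θ * c) * (√(1 - 2 * θ))⁻¹ ^ s.card) := by
  have hind : iIndepFun (fun (i : ι) (x : ι → ℝ) => x i ^ 2) (iidGaussian ι) :=
    iIndepFun_pi (X := fun _ x => x ^ 2) fun i => by fun_prop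
  have hmp : ∀ i, MeasurePreserving (fun x : ι → ℝ => x i) (iidGaussian ι) (gaussianReal 0 1) :=
    fun i => measurePreserving_eval _ i
  have hint : ∀ i, Integrable (fun x : ι → ℝ => Real.exp (θ * x i ^ 2)) (iidGaussian ι) := fun i =>
    (hmp i).integrable_comp_of_integrable (integrable_exp_mul_sq_gaussianReal hθ)
  have hmgf : ∀ i, mgf (fun x : ι → ℝ => x i ^ 2) (iidGaussian ι) θ = (√(1 - 2 * θ))⁻¹ := fun i => by
    rw [← mgf_sq_gaussianReal hθ, ← (hmp i).map_eq, mgf_map (hmp i).aemeasurable (by fun_prop)]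
    rfl
  have h := measure_ge_le_exp_mul_mgf (μ := iidGaussian ι) (X := ∑ i ∈ s, fun x : ι → ℝ => x i ^ 2) c h0
    (hind.integrable_exp_mul_sum (fun i => by fun_prop) fun i _ => hint i)
  rw [hind.mgf_sum (fun i => by fun_prop), Finset.prod_congr rfl fun i _ => hmgf i,
    Finset.prod_const] at h
  rw [← ENNReal.ofReal_toReal (measure_ne_top (iidGaussian ι) _)]
  refine ENNReal.ofReal_le_ofReal ?_
  simpa [Measure.real] using h

/-! ### Induction on dimension for the quadratic form -/

/-- The matrices `A` for which the quadratic form `⟪u, A u⟫ + κ ⟪v, u⟫ ^ 2` exceeds `t ‖u‖ ^ 2`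
for some `u`. -/
def exceedSet {n : ℕ} (t κ : ℝ) (v : Fin n → ℝ) : Set (Fin n × Fin n → ℝ) :=
  {A | ∃ u : Fin n → ℝ, t * (u ⬝ᵥ u) < ∑ i, ∑ j, A (i, j) * (u i * u j) + κ * (v ⬝ᵥ u) ^ 2}

/-- Openness makes the uncountable union over `u` measurable; having it jointly in `v` and `A` is
what the Fubini step needs. -/
lemma isOpen_setOf_mem_exceedSet {n : ℕ} (t κ : ℝ) :
    IsOpen {p : (Fin n → ℝ) × (Fin n × Fin n → ℝ) | p.2 ∈ exceedSet t κ p.1} := by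
  have h : {p : (Fin n → ℝ) × (Fin n × Fin n → ℝ) | p.2 ∈ exceedSet t κ p.1} =
      ⋃ u : Fin n → ℝ, {p | t * (u ⬝ᵥ u) <
        ∑ i, ∑ j, p.2 (i, j) * (u i * u j) + κ * (∑ i, p.1 i * u i) ^ 2} := by
    ext p; simp [exceedSet, dotProduct]
  rw [h]
  exact isOpen_iUnion fun u => isOpen_lt (by fun_prop) (by fun_prop)

lemma measurableSet_exceedSet {n : ℕ} (t κ : ℝ) (v : Fin n → ℝ) :
    MeasurableSet (exceedSet t κ v) :=
  ((isOpen_setOf_mem_exceedSet t κ).preimage (f := fun A => (v, A)) (by fun_prop)).measurableSet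

/-- The Householder reflection along `v - v'` exchanges two vectors of equal length. -/
lemma exists_symm_involutive_mulVec_eq {n : ℕ} {v v' : Fin n → ℝ} (h : v ⬝ᵥ v = v' ⬝ᵥ v') :
    ∃ H : Matrix (Fin n) (Fin n) ℝ, Hᵀ = H ∧ H * H = 1 ∧ H *ᵥ v = v' := by
  by_cases hv : v = v'
  · exact ⟨1, by simp, by simp, by simp [hv]⟩
  set w := v - v' with hw
  have hw0 : w ⬝ᵥ w ≠ 0 := by
    rw [Ne, dotProduct_self_eq_zero]
    exact sub_ne_zero.2 hv
  have hwv : w ⬝ᵥ w = 2 * (w ⬝ᵥ v) := by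
    simp only [hw, dotProduct_sub, sub_dotProduct, h, dotProduct_comm v' v]
    ring
  refine ⟨1 - (2 / (w ⬝ᵥ w)) • vecMulVec w w, by simp [transpose_vecMulVec], ?_, ?_⟩
  · rw [sub_mul, mul_sub, mul_sub, mul_one, one_mul, mul_one, smul_mul_smul_comm, vecMulVec_mul_vecMulVec,
      vecMulVec_smul, smul_smul]
    have : 2 / (w ⬝ᵥ w) * (2 / (w ⬝ᵥ w)) * (w ⬝ᵥ w) = 2 / (w ⬝ᵥ w) + 2 / (w ⬝ᵥ w) := by
      field_simp
      norm_num
    simp only [this, add_smul]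
    abel
  · rw [sub_mulVec, one_mulVec, smul_mulVec, vecMulVec_mulVec]
    have : 2 / (w ⬝ᵥ w) * (w ⬝ᵥ v) = 1 := by
      rw [div_mul_eq_mul_div, ← hwv, div_self hw0]
    ext i
    simp only [Pi.sub_apply, Pi.smul_apply, smul_eq_mul, MulOpposite.smul_eq_mul_unop,
      MulOpposite.unop_op]
    have hwi : w i = v i - v' i := rfl
    linear_combination (-w i) * this - hwi

/-- The law of a matrix with independent standard Gaussian entries is invariant under rotations. -/
lemma iidGaussian_exceedSet_le {n : ℕ} (t κ : ℝ) {v v' : Fin n → ℝ} (h : v ⬝ᵥ v = v' ⬝ᵥ v') :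
    iidGaussian (Fin n × Fin n) (exceedSet t κ v') ≤
      iidGaussian (Fin n × Fin n) (exceedSet t κ v) := by
  obtain ⟨H, hT, hH, hv⟩ := exists_symm_involutive_mulVec_eq h
  have hsym : ∀ i j, H i j = H j i := fun i j => by rw [← transpose_apply H, hT]
  have hHe : ∀ i j, ∑ k, H i k * H j k = if i = j then 1 else 0 := fun i j => by
    rw [← one_apply, ← hH, mul_apply]
    exact Finset.sum_congr rfl fun k _ => by rw [hsym j k]
  have hmp := measurePreserving_dotProduct_iidGaussian
    (fun (p q : Fin n × Fin n) => H p.1 q.1 * H p.2 q.2) (fun p q => by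
      simp only [dotProduct, Fintype.sum_prod_type]
      trans (∑ k, H p.1 k * H q.1 k) * ∑ l, H p.2 l * H q.2 l
      · rw [Finset.sum_mul_sum]
        exact Finset.sum_congr rfl fun i _ => Finset.sum_congr rfl fun j _ => by ring
      · rw [hHe, hHe]
        by_cases h1 : p.1 = q.1 <;> by_cases h2 : p.2 = q.2 <;> simp [Prod.ext_iff, h1, h2])
  rw [← hmp.measure_preimage (measurableSet_exceedSet t κ v').nullMeasurableSet]
  -- A witness `u` for `H A Hᵀ` and `v'` becomes the witness `H u` for `A` and `v`.
  refine measure_mono fun A ⟨u, hu⟩ => ⟨H *ᵥ u, ?_⟩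
  have e1 : (H *ᵥ u) ⬝ᵥ (H *ᵥ u) = u ⬝ᵥ u := by
    rw [dotProduct_mulVec, vecMul_mulVec, hT, hH, vecMul_one]
  have e2 : v ⬝ᵥ (H *ᵥ u) = v' ⬝ᵥ u := by
    rw [dotProduct_mulVec, ← mulVec_transpose, hT, hv]
  rw [e1, e2]
  convert hu using 2
  simp only [mulVec, dotProduct, Fintype.sum_prod_type, Finset.sum_mul, Finset.mul_sum]
  have e3 : ∀ f : Fin n → Fin n → Fin n → Fin n → ℝ,
      ∑ k, ∑ l, ∑ j, ∑ i, f i j k l = ∑ i, ∑ j, ∑ k, ∑ l, f i j k l := fun f =>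
    (Finset.sum_congr rfl fun k _ => Finset.sum_congr rfl fun l _ => Finset.sum_comm).trans (
    (Finset.sum_congr rfl fun k _ => Finset.sum_comm).trans (Finset.sum_comm.trans
      (Finset.sum_congr rfl fun i _ =>
        (Finset.sum_congr rfl fun k _ => Finset.sum_comm).trans Finset.sum_comm)))
  rw [e3]
  refine Finset.sum_congr rfl fun i _ => Finset.sum_congr rfl fun j _ =>
    Finset.sum_congr rfl fun k _ => Finset.sum_congr rfl fun l _ => ?_
  rw [hsym i k, hsym j l]
  ring

/-- The coefficient `1 / s` is a fixed point of the elimination: the old rank-one term and the AM-GM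
bound on the cross term each use `s / 2` of the budget for `u 0 ^ 2`, and the corner entry uses `α`.
-/
lemma mem_exceedSet_of_succ {n : ℕ} {s α c : ℝ} (hs : 0 < s) (hc : c ^ 2 ≤ s ^ 2 / 2)
    {A : Fin (n + 1) × Fin (n + 1) → ℝ} (ha : A (0, 0) ≤ α)
    (hA : A ∈ exceedSet (s + α) (1 / s) (Pi.single 0 c)) :
    (fun p : Fin n × Fin n => A (p.1.succ, p.2.succ)) ∈
      exceedSet (s + α) (1 / s) fun j => (A (0, j.succ) + A (j.succ, 0)) / √2 := by
  obtain ⟨u, hu⟩ := hA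
  refine ⟨fun i => u i.succ, ?_⟩
  have h2 : √2 ^ 2 = (2 : ℝ) := Real.sq_sqrt (by norm_num)
  have h20 : √2 ≠ (0 : ℝ) := by positivity
  set x := ∑ j : Fin n, (A (0, j.succ) + A (j.succ, 0)) / √2 * u j.succ with hx
  set q := ∑ i : Fin n, ∑ j : Fin n, A (i.succ, j.succ) * (u i.succ * u j.succ) with hq
  have e1 : ∑ i, ∑ j, A (i, j) * (u i * u j) = A (0, 0) * u 0 ^ 2 + √2 * u 0 * x + q := by
    simp only [Fin.sum_univ_succ, Finset.sum_add_distrib, hx, hq, Finset.mul_sum]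
    have : ∑ j : Fin n, √2 * u 0 * ((A (0, j.succ) + A (j.succ, 0)) / √2 * u j.succ) =
        ∑ j : Fin n, A (0, j.succ) * (u 0 * u j.succ) +
        ∑ j : Fin n, A (j.succ, 0) * (u j.succ * u 0) := by
      rw [← Finset.sum_add_distrib]
      exact Finset.sum_congr rfl fun j _ => by field_simp
    rw [this]
    ring
  rw [e1, single_dotProduct] at hu
  simp only [dotProduct, Fin.sum_univ_succ] at hu ⊢
  rw [← hx]
  have hamgm : √2 * u 0 * x ≤ s / 2 * u 0 ^ 2 + 1 / s * x ^ 2 := by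
    have : s / 2 * u 0 ^ 2 + 1 / s * x ^ 2 - √2 * u 0 * x = (s * u 0 - √2 * x) ^ 2 / (2 * s) := by
      field_simp
      linear_combination (-x ^ 2) * h2
    have : 0 ≤ (s * u 0 - √2 * x) ^ 2 / (2 * s) := by positivity
    linarith
  have hk : 1 / s * (c * u 0) ^ 2 ≤ s / 2 * u 0 ^ 2 := by
    have : 1 / s * (c * u 0) ^ 2 ≤ 1 / s * (s ^ 2 / 2 * u 0 ^ 2) := by
      rw [mul_pow]; gcongr
    refine this.trans_eq ?_
    field_simp
  have ha' : A (0, 0) * u 0 ^ 2 ≤ α * u 0 ^ 2 := by gcongr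
  linarith

/-- The corner, the symmetrised first row and column, and the remaining block of a matrix with
independent standard Gaussian entries. -/
lemma measurePreserving_corner_border_block (n : ℕ) :
    MeasurePreserving (fun A : Fin (n + 1) × Fin (n + 1) → ℝ =>
      ((fun o : Option (Fin n) => o.elim (A (0, 0)) fun j => (A (0, j.succ) + A (j.succ, 0)) / √2),
        fun p : Fin n × Fin n => A (p.1.succ, p.2.succ)))
      (iidGaussian (Fin (n + 1) × Fin (n + 1)))
      ((iidGaussian (Option (Fin n))).prod (iidGaussian (Fin n × Fin n))) := by
  have h3 : (√2)⁻¹ * (√2)⁻¹ = (1 / 2 : ℝ) := by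
    rw [← mul_inv, Real.mul_self_sqrt (by norm_num)]; norm_num
  have key := measurePreserving_dotProduct_iidGaussian
    (fun k : Option (Fin n) ⊕ (Fin n × Fin n) => (Sum.elim (fun o : Option (Fin n) =>
      o.elim (Pi.single ((0 : Fin (n + 1)), (0 : Fin (n + 1))) (1 : ℝ)) fun j =>
        (√2)⁻¹ • (Pi.single ((0 : Fin (n + 1)), j.succ) (1 : ℝ) +
          Pi.single (j.succ, (0 : Fin (n + 1))) (1 : ℝ)))
      (fun p => Pi.single (p.1.succ, p.2.succ) (1 : ℝ)) k)) (by
    rintro ((_ | j) | p) ((_ | k) | q) <;>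
      simp [Pi.single_apply, Prod.ext_iff, Fin.succ_ne_zero, (Fin.succ_ne_zero _).symm, eq_comm]
    · split_ifs <;> norm_num [h3])
  have := (measurePreserving_sumPiEquivProdPi
    (fun _ : Option (Fin n) ⊕ (Fin n × Fin n) => gaussianReal 0 1)).comp key
  convert this using 1
  funext A
  refine Prod.ext ?_ ?_
  · funext o
    cases o <;> simp [MeasurableEquiv.sumPiEquivProdPi, Equiv.sumPiEquivProdPi, add_dotProduct,
      div_eq_inv_mul, mul_add]
  · funext p
    simp [MeasurableEquiv.sumPiEquivProdPi, Equiv.sumPiEquivProdPi]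

lemma iidGaussian_exceedSet_succ_le {n : ℕ} {s α θ : ℝ} (hs : 0 < s) (hα : 0 ≤ α) (h0 : 0 ≤ θ)
    (hθ : θ < 1 / 2) {p : ENNReal}
    (hp : ∀ v : Fin n → ℝ, v ⬝ᵥ v ≤ s ^ 2 / 2 →
      iidGaussian (Fin n × Fin n) (exceedSet (s + α) (1 / s) v) ≤ p)
    (v : Fin (n + 1) → ℝ) (hv : v ⬝ᵥ v ≤ s ^ 2 / 2) :
    iidGaussian (Fin (n + 1) × Fin (n + 1)) (exceedSet (s + α) (1 / s) v) ≤
      ENNReal.ofReal (Real.exp (-θ * α ^ 2) * (√(1 - 2 * θ))⁻¹) +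
        ENNReal.ofReal (Real.exp (-θ * (s ^ 2 / 2)) * (√(1 - 2 * θ))⁻¹ ^ n) + p := by
  have hv0 : 0 ≤ v ⬝ᵥ v := by
    rw [dotProduct]; exact Finset.sum_nonneg fun i _ => mul_self_nonneg _
  set c := √(v ⬝ᵥ v)
  have hc : c ^ 2 = v ⬝ᵥ v := Real.sq_sqrt hv0
  refine (iidGaussian_exceedSet_le (v := Pi.single 0 c) _ _ (by simp [← hc, sq])).trans ?_
  have hmp := measurePreserving_corner_border_block n
  -- The three ways to fail: a large corner entry, a long border vector, or a short border vector
  -- whose remaining block exceeds.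
  set S : Set (Option (Fin n) → ℝ) := {y | α ^ 2 ≤ ∑ i ∈ {none}, y i ^ 2}
  set T : Set (Option (Fin n) → ℝ) := {y | s ^ 2 / 2 ≤ ∑ i ∈ Finset.univ.map .some, y i ^ 2}
  set R : Set ((Option (Fin n) → ℝ) × (Fin n × Fin n → ℝ)) :=
    {q | ∑ i ∈ Finset.univ.map .some, q.1 i ^ 2 ≤ s ^ 2 / 2 ∧
      q.2 ∈ exceedSet (s + α) (1 / s) fun j => q.1 (some j)}
  have hR : MeasurableSet R := by
    refine (measurableSet_le (f := fun q : (Option (Fin n) → ℝ) × (Fin n × Fin n → ℝ) =>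
      ∑ i ∈ Finset.univ.map .some, q.1 i ^ 2) (by fun_prop) (by fun_prop)).inter ?_
    exact ((isOpen_setOf_mem_exceedSet (s + α) (1 / s)).preimage
      (f := fun q : (Option (Fin n) → ℝ) × (Fin n × Fin n → ℝ) => ((fun j => q.1 (some j)), q.2))
      (by fun_prop)).measurableSet
  have hS : MeasurableSet S := measurableSet_le (by fun_prop) (by fun_prop)
  have hT : MeasurableSet T := measurableSet_le (by fun_prop) (by fun_prop)
  have hsub : exceedSet (s + α) (1 / s) (Pi.single (0 : Fin (n + 1)) c) ⊆
      (fun A : Fin (n + 1) × Fin (n + 1) → ℝ =>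
      ((fun o : Option (Fin n) => o.elim (A (0, 0)) fun j => (A (0, j.succ) + A (j.succ, 0)) / √2),
        fun p : Fin n × Fin n => A (p.1.succ, p.2.succ))) ⁻¹' (S ×ˢ Set.univ ∪ T ×ˢ Set.univ ∪ R) := by
    intro A hA
    by_cases ha : A (0, 0) ≤ α
    · have := mem_exceedSet_of_succ hs (hc.trans_le hv) ha hA
      rcases le_total (s ^ 2 / 2) (∑ i : Fin n, ((A (0, i.succ) + A (i.succ, 0)) / √2) ^ 2) with h | h
      · refine Or.inl (Or.inr ⟨?_, trivial⟩)
        simpa [T] using h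
      · refine Or.inr ⟨?_, this⟩
        simpa using h
    · refine Or.inl (Or.inl ⟨?_, trivial⟩)
      have : α ^ 2 ≤ A (0, 0) ^ 2 := by gcongr; exact (not_le.1 ha).le
      simpa [S] using this
  refine (measure_mono hsub).trans ?_
  rw [hmp.measure_preimage (((hS.prod .univ).union (hT.prod .univ)).union hR).nullMeasurableSet]
  refine (measure_union_le _ _).trans (add_le_add ((measure_union_le _ _).trans (add_le_add ?_ ?_)) ?_)
  · rw [Measure.prod_prod, measure_univ, mul_one]
    simpa [S] using iidGaussian_sum_sq_ge_le ({none} : Finset (Option (Fin n))) h0 hθ (α ^ 2)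
  · rw [Measure.prod_prod, measure_univ, mul_one]
    simpa [T] using iidGaussian_sum_sq_ge_le (Finset.univ.map (.some (α := Fin n))) h0 hθ (s ^ 2 / 2)
  -- With the border fixed, the independent block faces a fixed `v` of admissible length, so the
  -- inductive bound applies slice by slice.
  · rw [Measure.prod_apply hR]
    refine (lintegral_mono (g := fun _ => p) fun y => ?_).trans_eq (by simp)
    by_cases hy : ∑ i ∈ Finset.univ.map .some, y i ^ 2 ≤ s ^ 2 / 2
    · refine (measure_mono fun A hA => hA.2).trans (hp (fun j => y (some j)) ?_)
      simpa [dotProduct, sq] using hy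
    · refine (measure_mono_null (t := ∅) (fun A hA => hy hA.1) measure_empty).trans_le zero_le

lemma iidGaussian_exceedSet_le_nsmul {N : ℕ} {s α θ : ℝ} (hs : 0 < s) (hα : 0 ≤ α) (h0 : 0 ≤ θ)
    (hθ : θ < 1 / 2) {n : ℕ} (hn : n ≤ N) (v : Fin n → ℝ) (hv : v ⬝ᵥ v ≤ s ^ 2 / 2) :
    iidGaussian (Fin n × Fin n) (exceedSet (s + α) (1 / s) v) ≤
      n * (ENNReal.ofReal (Real.exp (-θ * α ^ 2) * (√(1 - 2 * θ))⁻¹) +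
        ENNReal.ofReal (Real.exp (-θ * (s ^ 2 / 2)) * (√(1 - 2 * θ))⁻¹ ^ N)) := by
  induction n with
  | zero => simp [exceedSet]
  | succ n ih =>
    refine (iidGaussian_exceedSet_succ_le hs hα h0 hθ (ih (by omega)) v hv).trans ?_
    -- This allows the exponent at each stage to be raised to `N`, so all steps share one bound.
    have hM : 1 ≤ (√(1 - 2 * θ))⁻¹ :=
      (one_le_inv₀ (Real.sqrt_pos.2 (by linarith))).2 (Real.sqrt_le_one.2 (by linarith))
    rw [Nat.cast_succ, add_mul, one_mul, add_comm]
    gcongr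
    omega

/-! ### Transfer to the Wigner matrix -/

lemma sum_sum_eq_diag_add_lower {n : ℕ} (f : Fin n → Fin n → ℝ) :
    ∑ i, ∑ j, f i j = ∑ i, f i i +
      ∑ p : {p : Fin n × Fin n // p.2 < p.1}, (f p.1.1 p.1.2 + f p.1.2 p.1.1) := by
  have hlow : ∀ g : Fin n → Fin n → ℝ, ∑ p : {p : Fin n × Fin n // p.2 < p.1}, g p.1.1 p.1.2 =
      ∑ i, ∑ j, if j < i then g i j else 0 := fun g => by
    rw [← Fintype.sum_prod_type' (f := fun i j => if j < i then g i j else 0), ← Finset.sum_filter]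
    exact (Finset.sum_subtype _ (by simp) fun p : Fin n × Fin n => g p.1 p.2).symm
  rw [Finset.sum_add_distrib, hlow f, hlow fun i j => f j i,
    Finset.sum_comm (f := fun i j => if j < i then f j i else 0), ← Finset.sum_add_distrib,
    ← Finset.sum_add_distrib]
  refine Finset.sum_congr rfl fun i _ => ?_
  trans (∑ j, if i = j then f i j else 0) + ((∑ j, if j < i then f i j else 0) +
    ∑ j, if i < j then f i j else 0)
  · rw [← Finset.sum_add_distrib, ← Finset.sum_add_distrib]
    refine Finset.sum_congr rfl fun j _ => ?_
    rcases lt_trichotomy i j with h | h | h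
    · simp [h, h.ne, h.not_gt]
    · simp [h]
    · simp [h, h.ne', h.not_gt]
  · simp

lemma IsGaussianWigner.hasLaw_lower {Ω : Type*} [MeasurableSpace Ω] {n : ℕ}
    {W : Ω → Matrix (Fin n) (Fin n) ℝ} {P : Measure Ω} (hW : IsGaussianWigner W P) :
    HasLaw (fun ω (p : {p : Fin n × Fin n // p.2 < p.1}) => W ω p.1.1 p.1.2)
      (iidGaussian {p : Fin n × Fin n // p.2 < p.1}) P :=
  hW.indep.hasLaw_pi fun p => hW.hasLaw p.1.1 p.1.2 p.2

lemma IsGaussianWigner.neg {Ω : Type*} [MeasurableSpace Ω] {n : ℕ}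
    {W : Ω → Matrix (Fin n) (Fin n) ℝ} {P : Measure Ω} (hW : IsGaussianWigner W P) :
    IsGaussianWigner (fun ω => -W ω) P where
  symm ω := (hW.symm ω).neg
  diag_eq_zero ω i := by simp [hW.diag_eq_zero]
  hasLaw i j hij := by
    have h := gaussianReal_neg (hW.hasLaw i j hij)
    rw [neg_zero] at h
    exact h
  indep := hW.indep.comp (fun _ x => -x) fun _ => measurable_neg

lemma IsGaussianWigner.quadForm_eq {Ω : Type*} [MeasurableSpace Ω] {n : ℕ}
    {W : Ω → Matrix (Fin n) (Fin n) ℝ} {P : Measure Ω} (hW : IsGaussianWigner W P) (ω : Ω)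
    (u : Fin n → ℝ) : ∑ i, ∑ j, W ω i j * (u i * u j) =
      ∑ p : {p : Fin n × Fin n // p.2 < p.1}, 2 * W ω p.1.1 p.1.2 * (u p.1.1 * u p.1.2) := by
  rw [sum_sum_eq_diag_add_lower]
  simp only [hW.diag_eq_zero, zero_mul, Finset.sum_const_zero, zero_add]
  refine Finset.sum_congr rfl fun p _ => ?_
  rw [(hW.symm ω).apply p.1.1 p.1.2]
  ring

lemma measurePreserving_symmetrize_lower (n : ℕ) :
    MeasurePreserving (fun (A : Fin n × Fin n → ℝ) (p : {p : Fin n × Fin n // p.2 < p.1}) =>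
      (A (p.1.1, p.1.2) + A (p.1.2, p.1.1)) / √2) (iidGaussian (Fin n × Fin n))
      (iidGaussian {p : Fin n × Fin n // p.2 < p.1}) := by
  have h3 : (√2)⁻¹ * (√2)⁻¹ = (1 / 2 : ℝ) := by
    rw [← mul_inv, Real.mul_self_sqrt (by norm_num)]; norm_num
  have key := measurePreserving_dotProduct_iidGaussian
    (fun p : {p : Fin n × Fin n // p.2 < p.1} =>
      (√2)⁻¹ • (Pi.single (p.1.1, p.1.2) (1 : ℝ) + Pi.single (p.1.2, p.1.1) (1 : ℝ))) (by
    rintro ⟨⟨i, j⟩, hp⟩ ⟨⟨k, l⟩, hq⟩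
    simp only at hp hq
    have h1 : ¬ (k = j ∧ l = i) := by omega
    have h2 : ¬ (l = i ∧ k = j) := by omega
    by_cases h : i = k ∧ j = l
    · obtain ⟨rfl, rfl⟩ := h
      simp [hp.ne, hp.ne']
      norm_num [h3]
    · have h4 : ¬ (k = i ∧ l = j) := by tauto
      have h5 : ¬ (l = j ∧ k = i) := by tauto
      simp [h, h1, h2, h4, h5])
  convert key using 3
  simp [add_dotProduct, div_eq_inv_mul, mul_add]

lemma IsGaussianWigner.measure_exceed_le {Ω : Type*} [MeasurableSpace Ω] {n : ℕ}
    {W : Ω → Matrix (Fin n) (Fin n) ℝ} {P : Measure Ω} (hW : IsGaussianWigner W P)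
    {s α θ : ℝ} (hs : 0 < s) (hα : 0 ≤ α) (h0 : 0 ≤ θ) (hθ : θ < 1 / 2) :
    P {ω | ∃ u : Fin n → ℝ, √2 * (s + 2 * α) * (u ⬝ᵥ u) < ∑ i, ∑ j, W ω i j * (u i * u j)} ≤
      n * (ENNReal.ofReal (Real.exp (-θ * α ^ 2) * (√(1 - 2 * θ))⁻¹) +
        ENNReal.ofReal (Real.exp (-θ * (s ^ 2 / 2)) * (√(1 - 2 * θ))⁻¹ ^ n)) +
      n * ENNReal.ofReal (Real.exp (-θ * α ^ 2) * (√(1 - 2 * θ))⁻¹) := by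
  set G : Set ({p : Fin n × Fin n // p.2 < p.1} → ℝ) :=
    ⋃ u : Fin n → ℝ, {w | √2 * (s + 2 * α) * (u ⬝ᵥ u) < ∑ p, 2 * w p * (u p.1.1 * u p.1.2)}
  have hG : MeasurableSet G :=
    (isOpen_iUnion fun u => isOpen_lt (by fun_prop) (by fun_prop)).measurableSet
  have e : {ω | ∃ u : Fin n → ℝ, √2 * (s + 2 * α) * (u ⬝ᵥ u) <
      ∑ i, ∑ j, W ω i j * (u i * u j)} =
      {ω | (fun p : {p : Fin n × Fin n // p.2 < p.1} => W ω p.1.1 p.1.2) ∈ G} := by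
    ext ω
    simp [G, hW.quadForm_eq]
  rw [e, hW.hasLaw_lower.measure_eq (p := (· ∈ G)) hG]
  change iidGaussian _ G ≤ _
  rw [← (measurePreserving_symmetrize_lower n).measure_preimage hG.nullMeasurableSet]
  -- The form of `W` is `√2` times that of `A` with its diagonal removed. Diagonal entries below `α`
  -- in absolute value cost one more `α`, hence `s + 2 * α`.
  have hsub : (fun (A : Fin n × Fin n → ℝ) (p : {p : Fin n × Fin n // p.2 < p.1}) =>
      (A (p.1.1, p.1.2) + A (p.1.2, p.1.1)) / √2) ⁻¹' G ⊆ exceedSet (s + α) (1 / s) 0 ∪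
      ⋃ i : Fin n, {A | α ^ 2 ≤ ∑ k ∈ {(i, i)}, A k ^ 2} := by
    intro A hA
    by_contra hcon
    simp only [exceedSet, Set.mem_union, Set.mem_iUnion, Set.mem_ofPred_eq, not_or, not_exists,
      not_lt, not_le, Finset.sum_singleton, zero_dotProduct] at hcon
    obtain ⟨hc1, hc2⟩ := hcon
    obtain ⟨u, hu⟩ := Set.mem_iUnion.1 hA
    have h1 := hc1 u
    rw [sum_sum_eq_diag_add_lower] at h1
    have h2 : -(α * (u ⬝ᵥ u)) ≤ ∑ i, A (i, i) * (u i * u i) := by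
      rw [dotProduct, Finset.mul_sum, ← Finset.sum_neg_distrib]
      refine Finset.sum_le_sum fun i _ => ?_
      have := (abs_lt_of_sq_lt_sq' (hc2 i) hα).1
      nlinarith [mul_self_nonneg (u i)]
    have h3 : ∑ p : {p : Fin n × Fin n // p.2 < p.1},
        2 * ((A (p.1.1, p.1.2) + A (p.1.2, p.1.1)) / √2) * (u p.1.1 * u p.1.2) =
        √2 * ∑ p : {p : Fin n × Fin n // p.2 < p.1}, (A (p.1.1, p.1.2) * (u p.1.1 * u p.1.2) +
          A (p.1.2, p.1.1) * (u p.1.2 * u p.1.1)) := by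
      rw [Finset.mul_sum]
      refine Finset.sum_congr rfl fun p _ => ?_
      have hsq : √2 ^ 2 = (2 : ℝ) := Real.sq_sqrt (by norm_num)
      have h20 : √2 ≠ (0 : ℝ) := by positivity
      field_simp
      rw [hsq]
      ring
    have h4 : √2 * (s + 2 * α) * (u ⬝ᵥ u) < _ := hu
    rw [h3, mul_assoc] at h4
    have := lt_of_mul_lt_mul_left h4 (by positivity)
    linarith
  refine (measure_mono hsub).trans ((measure_union_le _ _).trans (add_le_add ?_ ?_))
  · exact iidGaussian_exceedSet_le_nsmul hs hα h0 hθ le_rfl 0 (by simp; positivity)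
  · refine (measure_iUnion_fintype_le _ _).trans ((Finset.sum_le_sum fun i _ =>
      iidGaussian_sum_sq_ge_le ({(i, i)} : Finset (Fin n × Fin n)) h0 hθ (α ^ 2)).trans_eq ?_)
    simp

/-! ### Asymptotics and conclusion -/

lemma tendsto_natCast_mul_ofReal_exp {c : ℝ} (hc : 0 < c) (M : ℝ) :
    Tendsto (fun n : ℕ => (n : ENNReal) * ENNReal.ofReal (M * Real.exp (-c * n))) atTop (𝓝 0) := by
  have h := (tendsto_self_mul_const_pow_of_lt_one (Real.exp_pos (-c)).le
    (Real.exp_lt_one_iff.2 (by linarith))).const_mul M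
  rw [mul_zero] at h
  have h2 := ENNReal.tendsto_ofReal h
  rw [ENNReal.ofReal_zero] at h2
  refine h2.congr fun n => ?_
  rw [← ENNReal.ofReal_natCast, ← ENNReal.ofReal_mul (by positivity), ← Real.exp_nat_mul]
  congr 1
  rw [mul_comm (n : ℝ) (-c)]
  ring

/-- The largest eigenvalue of a Gaussian Wigner matrix is at most `C * √n`, for each `C > 2`, with
high probability. -/
lemma tendsto_measure_quadForm_gt {Ω : ℕ → Type*} [∀ n, MeasurableSpace (Ω n)]
    {P : ∀ n, Measure (Ω n)} {W : ∀ n, Ω n → Matrix (Fin n) (Fin n) ℝ}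
    (hW : ∀ n, IsGaussianWigner (W n) (P n)) {C : ℝ} (hC : 2 < C) :
    Tendsto (fun n => P n {ω | ∃ u : Fin n → ℝ,
      C * √n * (u ⬝ᵥ u) < ∑ i, ∑ j, W n ω i j * (u i * u j)}) atTop (𝓝 0) := by
  -- With `s = √2 (1 + η) √n` and `α = η √n` below, the threshold is `(2 + (2 + 2√2) η) √n`, and `2
  -- + 2√2 ≤ 5`.
  set η := (C - 2) / 5 with hη
  have hη0 : 0 < η := by rw [hη]; linarith
  -- Chosen so that `1 - 2θ = 1 / (1 + η)`, which makes the Gaussian factor at most `exp (η / 2)`.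
  set θ := η / (2 * (1 + η)) with hθd
  have hθ0 : 0 < θ := by positivity
  have hθe : 1 - 2 * θ = (1 + η)⁻¹ := by rw [hθd]; field_simp; ring
  have hθ : θ < 1 / 2 := by
    have : 0 < (1 + η)⁻¹ := by positivity
    linarith
  set M := (√(1 - 2 * θ))⁻¹ with hM
  have hM0 : 0 ≤ M := by positivity
  have hMe : M ≤ Real.exp (η / 2) := by
    rw [hM, hθe, Real.sqrt_inv, inv_inv, Real.sqrt_le_left (Real.exp_pos _).le, ← Real.exp_nat_mul]
    have := Real.add_one_le_exp η
    convert this using 1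
    · ring
    · congr 1; push_cast; ring
  have hlim : Tendsto (fun n : ℕ => (n : ENNReal) * ENNReal.ofReal (M * Real.exp (-(θ * η ^ 2) * n)) +
      n * ENNReal.ofReal (1 * Real.exp (-(η ^ 2 / 2) * n)) +
      n * ENNReal.ofReal (M * Real.exp (-(θ * η ^ 2) * n))) atTop (𝓝 0) := by
    have h1 := tendsto_natCast_mul_ofReal_exp (c := θ * η ^ 2) (by positivity) M
    have h2 := tendsto_natCast_mul_ofReal_exp (c := η ^ 2 / 2) (by positivity) 1
    simpa using (h1.add h2).add h1
  refine tendsto_of_tendsto_of_tendsto_of_le_of_le' tendsto_const_nhds hlim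
    (Eventually.of_forall fun n => zero_le) ?_
  filter_upwards [eventually_gt_atTop 0] with n hn
  have hnR : (0 : ℝ) < n := by exact_mod_cast hn
  have hs0 : 0 < √(n : ℝ) := Real.sqrt_pos.2 hnR
  have hsq : √(n : ℝ) ^ 2 = n := Real.sq_sqrt hnR.le
  have h2 : √2 ^ 2 = (2 : ℝ) := Real.sq_sqrt (by norm_num)
  have h := (hW n).measure_exceed_le (s := √2 * (1 + η) * √n) (α := η * √n) (by positivity)
    (by positivity) hθ0.le hθ
  refine (measure_mono ?_).trans (h.trans ?_)
  · rintro ω ⟨u, hu⟩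
    refine ⟨u, lt_of_le_of_lt ?_ hu⟩
    have hu0 : 0 ≤ u ⬝ᵥ u := by
      rw [dotProduct]; exact Finset.sum_nonneg fun i _ => mul_self_nonneg _
    refine mul_le_mul_of_nonneg_right ?_ hu0
    have h15 : √2 ≤ (3 / 2 : ℝ) := by
      rw [Real.sqrt_le_left (by norm_num)]; norm_num
    have hCe : C = 2 + 5 * η := by rw [hη]; ring
    rw [hCe]
    have : √2 * (√2 * (1 + η) * √n + 2 * (η * √n)) = (2 * (1 + η) + 2 * √2 * η) * √n := by
      linear_combination (1 + η) * √n * h2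
    rw [this]
    exact mul_le_mul_of_nonneg_right (by nlinarith) hs0.le
  · have ea : Real.exp (-θ * (η * √n) ^ 2) * M = M * Real.exp (-(θ * η ^ 2) * n) := by
      rw [mul_pow, hsq, mul_comm]
      congr 2; ring
    rw [ea, mul_add]
    gcongr _ + _ * ENNReal.ofReal ?_ + _
    -- Here `s² / 2 = (1 + η)² n` and `θ (1 + η)² = η (1 + η) / 2`, which leaves the rate `η² / 2`.
    calc Real.exp (-θ * ((√2 * (1 + η) * √n) ^ 2 / 2)) * M ^ n
        ≤ Real.exp (-θ * ((√2 * (1 + η) * √n) ^ 2 / 2)) * Real.exp (η / 2) ^ n := by gcongr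
      _ = 1 * Real.exp (-(η ^ 2 / 2) * n) := by
        rw [← Real.exp_nat_mul, ← Real.exp_add, one_mul, mul_pow, mul_pow, h2, hsq, hθd]
        congr 1
        field_simp
        ring

theorem mainTheorem4 (lam : ℝ) (hlam : 8 < lam) :
    ∃ ε : ℝ, 0 < ε ∧
      ∀ (Ω : ℕ → Type*) [∀ n, MeasurableSpace (Ω n)]
        (P : ∀ n, Measure (Ω n)) [∀ n, IsProbabilityMeasure (P n)]
        (W : ∀ n, Ω n → Matrix (Fin n) (Fin n) ℝ) (_ : ∀ n, IsGaussianWigner (W n) (P n))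
        (z : ∀ n, Fin n → ℝ) (_ : ∀ n i, z n i = 1 ∨ z n i = -1),
        WithHighProbability P (fun n => {ω | ∀ Q : Matrix (Fin n) (Fin 2) ℝ,
          IsRank2BMSecondOrderCritical (sigmaModel (√(n : ℝ) / lam) (z n) (W n ω)) Q →
            ε ≤ 1 / (n : ℝ) * ‖WithLp.toLp 2 (Qᵀ *ᵥ z n)‖}) ∧
        WithHighProbability P (fun n => {ω | ∀ Q : Matrix (Fin n) (Fin 2) ℝ,
          IsRank2BMSecondOrderCritical (lambdaModel lam (z n) (W n ω)) Q →
            ε ≤ 1 / (n : ℝ) * ‖WithLp.toLp 2 (Qᵀ *ᵥ z n)‖}) := by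
  have hlam0 : 0 < lam := by linarith
  -- The midpoint of 2 and `lam / 4`: above the spectral threshold, yet with `4C < lam`.
  set C := (8 + lam) / 8 with hC
  have hC2 : 2 < C := by rw [hC]; linarith
  have hgap : 0 < 1 / 2 - 2 * C / lam := by
    rw [hC, sub_pos, div_lt_div_iff₀ hlam0 (by norm_num)]
    linarith
  refine ⟨√(1 / 2 - 2 * C / lam), Real.sqrt_pos.2 hgap, ?_⟩
  intro Ω _ P _ W hW z hz
  -- Applying the one-sided bound to `-W` as well controls the form in absolute value.
  have hlim := (tendsto_measure_quadForm_gt hW hC2).add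
    (tendsto_measure_quadForm_gt (fun n => (hW n).neg) hC2)
  rw [add_zero] at hlim
  have hgood : ∀ n : ℕ, 0 < n → ∀ ω ∉ {ω | ∃ u : Fin n → ℝ,
      C * √n * (u ⬝ᵥ u) < ∑ i, ∑ j, W n ω i j * (u i * u j)} ∪ {ω | ∃ u : Fin n → ℝ,
      C * √n * (u ⬝ᵥ u) < ∑ i, ∑ j, (-W n ω) i j * (u i * u j)}, ∀ Q ∈ productOfCircles n,
      0 ≤ ∑ i, ∑ j, lambdaModel lam (z n) (W n ω) i j * ((Q i 0 * Q j 0 + Q i 1 * Q j 1) -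
        z n i * z n j * (Q i 0 * Q j 0 + Q i 1 * Q j 1) ^ 2) →
      √(1 / 2 - 2 * C / lam) ≤ 1 / (n : ℝ) * ‖WithLp.toLp 2 (Qᵀ *ᵥ z n)‖ := by
    intro n hn ω hω Q hQ h
    simp only [Set.mem_union, Set.mem_ofPred_eq, not_or, not_exists, not_lt, Matrix.neg_apply,
      neg_mul, Finset.sum_neg_distrib, dotProduct, ← sq] at hω
    refine Real.sqrt_le_iff.2 ⟨by positivity, correlation_lower_bound hn hlam0 (fun u => ?_) (hz n) hQ h⟩
    exact abs_le.2 ⟨by linarith [hω.2 u], hω.1 u⟩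
  constructor
  all_goals
    refine tendsto_of_tendsto_of_tendsto_of_le_of_le' tendsto_const_nhds hlim
      (Eventually.of_forall fun n => zero_le) ?_
    filter_upwards [eventually_gt_atTop 0] with n hn
    refine (measure_mono ?_).trans (measure_union_le _ _)
    rw [Set.compl_subset_comm]
    intro ω hω Q hQ
    refine hgood n hn ω hω Q hQ.1 ?_
    have hsum := hQ.sum_nonneg (hz n)
  -- The two cost matrices differ by the positive factor `n / lam`, which cancels from the Hessian
  -- inequality.
  · have hnR : (0 : ℝ) < n := by exact_mod_cast hn
    rw [sigmaModel_eq_smul_lambdaModel hn hlam0] at hsum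
    simp only [Matrix.smul_apply, smul_eq_mul, mul_assoc, ← Finset.mul_sum] at hsum
    simpa only [mul_assoc] using nonneg_of_mul_nonneg_right hsum (div_pos hnR hlam0)
  · exact hsum
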